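/- Let $\mathbb K$ be a field of characteristic $0$. Let $\mathbf{FQSym}=\bigoplus_{n\ge 0}\mathbb K[\mathfrak S_n]$ be the algebra of free quasi-symmetric functions, with basis $\mathbf G_\sigma$ ($\sigma\in\mathfrak S_n$, $n\ge0$; a permutation $\sigma$ is identified with the word $\sigma(1)\cdots\sigma(n)$, and $\mathrm{std}$ denotes standardization of words), with * product $\mathbf G_\alpha\mathbf G_\beta=\sum_{\gamma}\mathbf G_\gamma$, the sum over all permutations $\gamma=u\cdot v$ with $\mathrm{std}(u)=\alpha$, $\mathrm{std}(v)=\beta$, and unit $\mathbf G_\emptyset$; * coproduct $\Delta\mathbf G_\sigma=\sum_{k=0}^{n}\mathbf G_{\mathrm{std}(\sigma|_{[1,k]})}\otimes\mathbf G_{\mathrm{std}(\sigma|_{[k+1,n]})}$ for $\sigma\in\mathfrak S_n$, where $\sigma|_{J}$ is the subword of $\sigma$ formed by its letters in $J$; the counit is the coefficient of $\mathbf G_\emptyset$; * internal product $\mathbf G_\sigma*\mathbf G_\tau=\mathbf G_{\tau\sigma}$ if $\sigma,\tau$ belong to the same symmetric group (where $(\tau\sigma)(i)=\tau(\sigma(i))$),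 and $\mathbf G_\sigma*\mathbf G_\tau=0$ otherwise. For $n\ge0$ let $\mathrm{Lie}_n\subseteq\mathbb K[\mathfrak S_n]$ be the set of elements $\sum_\sigma c_\sigma\sigma$ such that $\sum_\sigma c_\sigma\,x_{\sigma(1)}\cdots x_{\sigma(n)}$ lies in the free Lie algebra on $x_1,\dots,x_n$ (the Lie subalgebra of $\mathbb K\langle x_1,\dots,x_n\rangle$ generated by the letters). The Patras–Reutenauer algebra $\mathcal A\subseteq\mathbf{FQSym}$ is the linear span of all products $\pi_1\cdots\pi_s$ ($s\ge0$), where each $\pi_k$ is in the image of some $\mathrm{Lie}_{j_k}$ under $\sigma\mapsto\mathbf G_\sigma$. Then for every $r\ge0$, all $F_1,\dots,F_r\in\mathbf{FQSym}$ and every $H\in\mathcal A$, $$(F_1F_2\cdots F_r)*H=\mu_r\bigl[(F_1\otimes\cdots\otimes F_r)*\Delta^rH\bigr],$$ where $\mu_r:\mathbf{FQSym}^{\otimes r}\to\mathbf{FQSym}$ is the $r$-fold ordinary multiplication, $*$ on $\mathbf{FQSym}^{\otimes r}$ is the factorwise internal product, and $\Delta^r:\mathbf{FQSym}\to\mathbf{FQSym}^{\otimes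 r}$ is the iterated coproduct ($\Delta^0$ the counit, $\Delta^1=\mathrm{id}$, $\Delta^2=\Delta$, $\Delta^{r+1}=(\mathrm{id}\otimes\Delta^{r})\circ\Delta$). -/

import Mathlib

open scoped TensorProduct

/-- The standardization of a word `w` of length `n` over a linearly ordered alphabet, as a
permutation: `std w i < std w j` iff `w i < w j`, or `w i = w j` and `i < j`. -/
def std {X : Type*} [LinearOrder X] {n : ℕ} (w : Fin n → X) : Equiv.Perm (Fin n) :=
  (Tuple.sort w)⁻¹

theorem std_eq_iff {X : Type*} [LinearOrder X] {n : ℕ} {w : Fin n → X}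
    (hw : Function.Injective w) (σ : Equiv.Perm (Fin n)) :
    std w = σ ↔ ∀ i j, σ i < σ j ↔ w i < w j := by
  have key : std w = σ ↔ σ⁻¹ = Tuple.sort w := by
    unfold std; constructor
    · rintro rfl; simp
    · intro h; rw [← h]; simp
  rw [key, Tuple.eq_sort_iff]
  constructor
  · rintro ⟨hm, -⟩
    have hs : StrictMono (w ∘ ⇑σ⁻¹) := hm.strictMono_of_injective (hw.comp σ⁻¹.injective)
    intro i j
    have := hs.lt_iff_lt (a := σ i) (b := σ j)
    simpa using this.symm
  · intro h
    have hs : StrictMono (w ∘ ⇑σ⁻¹) := by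
      intro a b hab
      have := (h (σ⁻¹ a) (σ⁻¹ b)).1 (by simpa using hab)
      simpa using this
    refine ⟨hs.monotone, fun i j hij he => ?_⟩
    exact absurd (hs.injective he) (ne_of_lt hij)

theorem std_lt_iff {X : Type*} [LinearOrder X] {n : ℕ} {w : Fin n → X}
    (hw : Function.Injective w) (i j : Fin n) : std w i < std w j ↔ w i < w j :=
  (std_eq_iff hw _).1 rfl i j

theorem std_std_comp {X : Type*} [LinearOrder X] {m n : ℕ} {w : Fin n → X}
    (hw : Function.Injective w) {f : Fin m → Fin n} (hf : Function.Injective f) :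
    std (std w ∘ f) = std (w ∘ f) := by
  rw [std_eq_iff ((std w).injective.comp hf)]
  intro i j
  rw [std_lt_iff (hw.comp hf)]
  exact (std_lt_iff hw _ _).symm

theorem std_perm {n : ℕ} (σ : Equiv.Perm (Fin n)) : std σ = σ :=
  (std_eq_iff σ.injective σ).2 fun _ _ => Iff.rfl

/-- The underlying vector space of the algebra of free quasi-symmetric functions: the direct sum
of the group algebras of all symmetric groups `𝔖_n`, `n ≥ 0`. -/
def FQSym (K : Type*) [Field K] : Type _ := (Σ n : ℕ, Equiv.Perm (Fin n)) →₀ K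

namespace FQSym

variable (K : Type*) [Field K]

noncomputable instance : AddCommGroup (FQSym K) :=
  inferInstanceAs (AddCommGroup ((Σ n : ℕ, Equiv.Perm (Fin n)) →₀ K))

noncomputable instance : Module K (FQSym K) :=
  inferInstanceAs (Module K ((Σ n : ℕ, Equiv.Perm (Fin n)) →₀ K))

/-- The basis `(G_σ)`, indexed by all permutations. A permutation `σ` of `Fin n` is identified
with the word `σ 0, σ 1, …, σ (n-1)`. -/
noncomputable def basisG : Module.Basis (Σ n : ℕ, Equiv.Perm (Fin n)) K (FQSym K) :=
  Module.Basis.ofRepr (LinearEquiv.refl K _)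

/-- The basis element `G_σ`. -/
noncomputable def G {n : ℕ} (σ : Equiv.Perm (Fin n)) : FQSym K := basisG K ⟨n, σ⟩

/-- The bilinear map with prescribed values on pairs of basis elements `G_σ`, `G_τ`. -/
noncomputable def bilin {M : Type*} [AddCommGroup M] [Module K M]
    (f : ∀ {m n : ℕ}, Equiv.Perm (Fin m) → Equiv.Perm (Fin n) → M) :
    FQSym K →ₗ[K] FQSym K →ₗ[K] M :=
  (basisG K).constr K fun s => (basisG K).constr K fun t => f s.2 t.2

theorem bilin_G {M : Type*} [AddCommGroup M] [Module K M]
    (f : ∀ {m n : ℕ}, Equiv.Perm (Fin m) → Equiv.Perm (Fin n) → M) {m n : ℕ}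
    (σ : Equiv.Perm (Fin m)) (τ : Equiv.Perm (Fin n)) :
    bilin K f (G K σ) (G K τ) = f σ τ := by
  simp [bilin, G, Module.Basis.constr_basis]

/-- The ordinary product: `G_α G_β` is the sum of all `G_γ`, where `γ = u · v` as a word with
`std u = α` and `std v = β` (convolution of permutations). -/
noncomputable def mulLin : FQSym K →ₗ[K] FQSym K →ₗ[K] FQSym K :=
  bilin K fun {m n} α β =>
    ∑ γ : Equiv.Perm (Fin (m + n)),
      if std (fun i : Fin m => γ (Fin.castAdd n i)) = α ∧
          std (fun j : Fin n => γ (Fin.natAdd m j)) = β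
      then G K γ else 0

noncomputable instance : Mul (FQSym K) := ⟨fun x y => mulLin K x y⟩

/-- The unit is `G` of the empty permutation. -/
noncomputable instance : One (FQSym K) := ⟨G K (1 : Equiv.Perm (Fin 0))⟩

theorem mul_def (x y : FQSym K) : x * y = mulLin K x y := rfl

theorem one_def : (1 : FQSym K) = G K (1 : Equiv.Perm (Fin 0)) := rfl

theorem G_mul_G {m n : ℕ} (α : Equiv.Perm (Fin m)) (β : Equiv.Perm (Fin n)) :
    G K α * G K β = ∑ γ : Equiv.Perm (Fin (m + n)),
      if std (fun i : Fin m => γ (Fin.castAdd n i)) = α ∧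
          std (fun j : Fin n => γ (Fin.natAdd m j)) = β
      then G K γ else 0 := by
  rw [mul_def, mulLin, bilin_G]

theorem G_congr {m n : ℕ} (h : m = n) (σ : Equiv.Perm (Fin m)) :
    G K ((finCongr h).permCongr σ) = G K σ := by
  subst h
  rfl

theorem std_comp_congr {m n k : ℕ} (h : m = n) (σ : Equiv.Perm (Fin m)) (f : Fin k → Fin n) :
    std (fun i => (finCongr h).permCongr σ (f i)) = std (fun i => σ (Fin.cast h.symm (f i))) := by
  subst h
  rfl

@[elab_as_elim]
theorem induction_G {p : FQSym K → Prop} (x : FQSym K) (zero : p 0)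
    (add : ∀ x y, p x → p y → p (x + y)) (smul : ∀ (c : K) x, p x → p (c • x))
    (basis : ∀ {n : ℕ} (σ : Equiv.Perm (Fin n)), p (G K σ)) : p x := by
  have hx := (basisG K).mem_span x
  induction hx using Submodule.span_induction with
  | mem y hy => obtain ⟨⟨n, σ⟩, rfl⟩ := hy; exact basis σ
  | zero => exact zero
  | add _ _ _ _ h1 h2 => exact add _ _ h1 h2
  | smul c _ _ h => exact smul c _ h

theorem one_mul_aux (x : FQSym K) : 1 * x = x := by
  induction x using induction_G with
  | zero => simp [mul_def]
  | add x y hx hy => rw [mul_def] at *; rw [map_add, hx, hy]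
  | smul c x hx => rw [mul_def] at *; rw [map_smul, hx]
  | @basis n σ =>
    rw [one_def, G_mul_G]
    rw [Finset.sum_eq_single ((finCongr (Nat.zero_add n).symm).permCongr σ)]
    · rw [if_pos, G_congr]
      refine ⟨Subsingleton.elim _ _, ?_⟩
      rw [std_comp_congr]
      convert std_perm σ using 3 with i
      ext; simp
    · intro γ _ hγ
      rw [if_neg]
      rintro ⟨-, h⟩
      apply hγ
      rw [← h]
      obtain ⟨δ, rfl⟩ := (finCongr (Nat.zero_add n).symm).permCongr.surjective γ
      rw [std_comp_congr]
      congr 1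
      symm
      convert std_perm δ using 3 with i
      ext; simp
    · simp

theorem mul_one_aux (x : FQSym K) : x * 1 = x := by
  induction x using induction_G with
  | zero => simp [mul_def]
  | add x y hx hy => rw [mul_def] at *; rw [map_add, LinearMap.add_apply, hx, hy]
  | smul c x hx => rw [mul_def] at *; rw [map_smul, LinearMap.smul_apply, hx]
  | @basis n σ =>
    rw [one_def, G_mul_G]
    refine (Finset.sum_eq_single (σ : Equiv.Perm (Fin (n + 0))) ?_ ?_).trans ?_
    · intro γ _ hγ
      rw [if_neg]
      rintro ⟨h, -⟩
      exact hγ ((std_perm γ).symm.trans h)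
    · simp
    · rw [if_pos ⟨std_perm σ, Subsingleton.elim _ _⟩]

/-- A product of basis elements, multiplied by a third one on the right. -/
theorem G_mul_G_mul_G {l m n : ℕ} (α : Equiv.Perm (Fin l)) (β : Equiv.Perm (Fin m))
    (γ : Equiv.Perm (Fin n)) :
    G K α * G K β * G K γ = ∑ δ : Equiv.Perm (Fin (l + m + n)),
      if std (fun i : Fin l => δ (Fin.castAdd n (Fin.castAdd m i))) = α ∧
          std (fun i : Fin m => δ (Fin.castAdd n (Fin.natAdd l i))) = β ∧
          std (fun i : Fin n => δ (Fin.natAdd (l + m) i)) = γ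
      then G K δ else 0 := by
  rw [G_mul_G, mul_def, map_sum, LinearMap.sum_apply]
  have h1 : ∀ ε : Equiv.Perm (Fin (l + m)),
      mulLin K (if std (fun i : Fin l => ε (Fin.castAdd m i)) = α ∧
          std (fun j : Fin m => ε (Fin.natAdd l j)) = β then G K ε else 0) (G K γ) =
      ∑ δ : Equiv.Perm (Fin (l + m + n)),
        if ε = std (fun i : Fin (l + m) => δ (Fin.castAdd n i)) then
          (if std (fun i : Fin l => δ (Fin.castAdd n (Fin.castAdd m i))) = α ∧
            std (fun i : Fin m => δ (Fin.castAdd n (Fin.natAdd l i))) = β ∧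
            std (fun i : Fin n => δ (Fin.natAdd (l + m) i)) = γ
          then G K δ else 0) else 0 := by
    intro ε
    have h2 : ∀ δ : Equiv.Perm (Fin (l + m + n)),
        ε = std (fun i : Fin (l + m) => δ (Fin.castAdd n i)) →
        std (fun i : Fin l => ε (Fin.castAdd m i)) =
          std (fun i : Fin l => δ (Fin.castAdd n (Fin.castAdd m i))) ∧
        std (fun i : Fin m => ε (Fin.natAdd l i)) =
          std (fun i : Fin m => δ (Fin.castAdd n (Fin.natAdd l i))) := by
      rintro δ rfl
      have hi : Function.Injective (fun i : Fin (l + m) => δ (Fin.castAdd n i)) :=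
        δ.injective.comp (Fin.castAdd_injective _ _)
      exact ⟨std_std_comp hi (f := Fin.castAdd m) (Fin.castAdd_injective _ _),
        std_std_comp hi (f := Fin.natAdd l) (Fin.natAdd_injective _ _)⟩
    split_ifs with hε
    · rw [← mul_def, G_mul_G]
      refine Finset.sum_congr rfl fun δ _ => ?_
      by_cases he : ε = std (fun i : Fin (l + m) => δ (Fin.castAdd n i))
      · rw [if_pos he, ← (h2 δ he).1, ← (h2 δ he).2]
        simp [hε, ← he]
      · rw [if_neg he, if_neg fun h => he h.1.symm]
    · rw [map_zero, LinearMap.zero_apply]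
      refine (Finset.sum_eq_zero fun δ _ => ?_).symm
      by_cases he : ε = std (fun i : Fin (l + m) => δ (Fin.castAdd n i))
      · rw [if_pos he, ← (h2 δ he).1, ← (h2 δ he).2, if_neg fun h => hε ⟨h.1, h.2.1⟩]
      · rw [if_neg he]
  rw [Finset.sum_congr rfl fun ε _ => h1 ε, Finset.sum_comm]
  refine Finset.sum_congr rfl fun δ _ => ?_
  simp

theorem G_mul_mul_G {l m n : ℕ} (α : Equiv.Perm (Fin l)) (β : Equiv.Perm (Fin m))
    (γ : Equiv.Perm (Fin n)) :
    G K α * (G K β * G K γ) = ∑ δ : Equiv.Perm (Fin (l + (m + n))),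
      if std (fun i : Fin l => δ (Fin.castAdd (m + n) i)) = α ∧
          std (fun i : Fin m => δ (Fin.natAdd l (Fin.castAdd n i))) = β ∧
          std (fun i : Fin n => δ (Fin.natAdd l (Fin.natAdd m i))) = γ
      then G K δ else 0 := by
  rw [G_mul_G, mul_def, map_sum]
  have h1 : ∀ ε : Equiv.Perm (Fin (m + n)),
      mulLin K (G K α) (if std (fun i : Fin m => ε (Fin.castAdd n i)) = β ∧
          std (fun j : Fin n => ε (Fin.natAdd m j)) = γ then G K ε else 0) =
      ∑ δ : Equiv.Perm (Fin (l + (m + n))),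
        if ε = std (fun i : Fin (m + n) => δ (Fin.natAdd l i)) then
          (if std (fun i : Fin l => δ (Fin.castAdd (m + n) i)) = α ∧
            std (fun i : Fin m => δ (Fin.natAdd l (Fin.castAdd n i))) = β ∧
            std (fun i : Fin n => δ (Fin.natAdd l (Fin.natAdd m i))) = γ
          then G K δ else 0) else 0 := by
    intro ε
    have h2 : ∀ δ : Equiv.Perm (Fin (l + (m + n))),
        ε = std (fun i : Fin (m + n) => δ (Fin.natAdd l i)) →
        std (fun i : Fin m => ε (Fin.castAdd n i)) =
          std (fun i : Fin m => δ (Fin.natAdd l (Fin.castAdd n i))) ∧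
        std (fun i : Fin n => ε (Fin.natAdd m i)) =
          std (fun i : Fin n => δ (Fin.natAdd l (Fin.natAdd m i))) := by
      rintro δ rfl
      have hi : Function.Injective (fun i : Fin (m + n) => δ (Fin.natAdd l i)) :=
        δ.injective.comp (Fin.natAdd_injective _ _)
      exact ⟨std_std_comp hi (f := Fin.castAdd n) (Fin.castAdd_injective _ _),
        std_std_comp hi (f := Fin.natAdd m) (Fin.natAdd_injective _ _)⟩
    split_ifs with hε
    · rw [← mul_def, G_mul_G]
      refine Finset.sum_congr rfl fun δ _ => ?_
      by_cases he : ε = std (fun i : Fin (m + n) => δ (Fin.natAdd l i))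
      · rw [if_pos he, ← (h2 δ he).1, ← (h2 δ he).2]
        simp [hε, ← he]
      · rw [if_neg he, if_neg fun h => he h.2.symm]
    · rw [map_zero]
      refine (Finset.sum_eq_zero fun δ _ => ?_).symm
      by_cases he : ε = std (fun i : Fin (m + n) => δ (Fin.natAdd l i))
      · rw [if_pos he, ← (h2 δ he).1, ← (h2 δ he).2, if_neg fun h => hε h.2]
      · rw [if_neg he]
  rw [Finset.sum_congr rfl fun ε _ => h1 ε, Finset.sum_comm]
  refine Finset.sum_congr rfl fun δ _ => ?_
  simp

theorem mul_assoc_aux (x y z : FQSym K) : x * y * z = x * (y * z) := by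
  induction x using induction_G with
  | zero => simp [mul_def]
  | add a b ha hb =>
    simp only [mul_def] at *; simp only [map_add, LinearMap.add_apply, ha, hb]
  | smul c a ha => simp only [mul_def] at *; simp only [map_smul, LinearMap.smul_apply, ha]
  | @basis l α =>
  induction y using induction_G with
  | zero => simp [mul_def]
  | add a b ha hb =>
    simp only [mul_def] at *; simp only [map_add, LinearMap.add_apply, ha, hb]
  | smul c a ha => simp only [mul_def] at *; simp only [map_smul, LinearMap.smul_apply, ha]
  | @basis m β =>
  induction z using induction_G with
  | zero => simp [mul_def]
  | add a b ha hb => simp only [mul_def] at *; simp only [map_add, ha, hb]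
  | smul c a ha => simp only [mul_def] at *; simp only [map_smul, ha]
  | @basis n γ =>
  rw [G_mul_G_mul_G, G_mul_mul_G]
  refine Fintype.sum_equiv (finCongr (Nat.add_assoc l m n)).permCongr _ _ fun δ => ?_
  rw [G_congr, std_comp_congr, std_comp_congr, std_comp_congr]
  have e1 : ∀ i : Fin l, Fin.cast (Nat.add_assoc l m n).symm (Fin.castAdd (m + n) i) =
      Fin.castAdd n (Fin.castAdd m i) := fun i => rfl
  have e2 : ∀ i : Fin m, Fin.cast (Nat.add_assoc l m n).symm (Fin.natAdd l (Fin.castAdd n i)) =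
      Fin.castAdd n (Fin.natAdd l i) := fun i => rfl
  have e3 : ∀ i : Fin n, Fin.cast (Nat.add_assoc l m n).symm (Fin.natAdd l (Fin.natAdd m i)) =
      Fin.natAdd (l + m) i := fun i => by ext; simp [Nat.add_assoc]
  simp only [e1, e2, e3]

noncomputable instance : Ring (FQSym K) :=
  { (inferInstance : AddCommGroup (FQSym K)) with
    mul := (· * ·)
    one := 1
    mul_assoc := mul_assoc_aux K
    one_mul := one_mul_aux K
    mul_one := mul_one_aux K
    left_distrib := fun x y z => map_add (mulLin K x) y z
    right_distrib := fun x y z => by simp only [mul_def, map_add, LinearMap.add_apply]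
    zero_mul := fun x => by simp only [mul_def, map_zero, LinearMap.zero_apply]
    mul_zero := fun x => map_zero (mulLin K x) }

noncomputable instance : Algebra K (FQSym K) :=
  Algebra.ofModule
    (fun c x y => by simp only [mul_def, map_smul, LinearMap.smul_apply])
    (fun c x y => map_smul (mulLin K x) c y)

/-- The internal product: `G_σ * G_τ = G_{τσ}` if `σ` and `τ` are permutations of the same size,
and `0` otherwise, where `(τσ)(i) = τ(σ(i))`. -/
noncomputable def internal : FQSym K →ₗ[K] FQSym K →ₗ[K] FQSym K :=
  bilin K fun {m n} σ τ =>
    if h : m = n then G K (τ * (finCongr h).permCongr σ) else 0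

/-- For `k ≤ n`, the standardization of the subword of `σ` formed by its letters `< k`. These
letters, listed in the order of their positions `σ⁻¹ c` in the word `σ`, are that subword. -/
def lowPart {n : ℕ} (σ : Equiv.Perm (Fin n)) (k : Fin (n + 1)) : Equiv.Perm (Fin k) :=
  Tuple.sort fun c : Fin k => σ⁻¹ ⟨c, by omega⟩

/-- For `k ≤ n`, the standardization of the subword of `σ` formed by its letters `≥ k`
(the letters are shifted by `-k`). -/
def highPart {n : ℕ} (σ : Equiv.Perm (Fin n)) (k : Fin (n + 1)) : Equiv.Perm (Fin (n - k)) :=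
  Tuple.sort fun c : Fin (n - k) => σ⁻¹ ⟨k + c, by omega⟩

/-- The coproduct: `Δ G_σ = ∑_{k=0}^n G_{std(σ restricted to letters < k)} ⊗
G_{std(σ restricted to letters ≥ k)}`. -/
noncomputable def comul : FQSym K →ₗ[K] FQSym K ⊗[K] FQSym K :=
  (basisG K).constr K fun s =>
    ∑ k : Fin (s.1 + 1), G K (lowPart s.2 k) ⊗ₜ[K] G K (highPart s.2 k)

/-- The counit: the coefficient of `1 = G_∅`. -/
noncomputable def counit : FQSym K →ₗ[K] K := (basisG K).coord ⟨0, 1⟩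

/-- The identification `FQSym ⊗ FQSym^{⊗ r} → FQSym^{⊗ (r+1)}`,
`x ⊗ (x₁ ⊗ ⋯ ⊗ x_r) ↦ x ⊗ x₁ ⊗ ⋯ ⊗ x_r`. -/
noncomputable def consTensor (r : ℕ) :
    FQSym K ⊗[K] (⨂[K] _ : Fin r, FQSym K) →ₗ[K] ⨂[K] _ : Fin (r + 1), FQSym K :=
  TensorProduct.lift
    (PiTensorProduct.lift.toLinearMap ∘ₗ
      (PiTensorProduct.tprod K (s := fun _ : Fin (r + 1) => FQSym K)).curryLeft)

/-- The iterated coproduct `Δ^r : FQSym → FQSym^{⊗ r}`; here `Δ^0` is the counit, `Δ^1` the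
identity and `Δ^2` the coproduct. -/
noncomputable def iterComul : (r : ℕ) → FQSym K →ₗ[K] ⨂[K] _ : Fin r, FQSym K
  | 0 => (counit K).smulRight (PiTensorProduct.tprod K fun _ : Fin 0 => (0 : FQSym K))
  | 1 => (PiTensorProduct.subsingletonEquiv (R := K) (s := fun _ : Fin 1 => FQSym K)
      (0 : Fin 1)).symm.toLinearMap
  | r + 2 => consTensor K (r + 1) ∘ₗ (iterComul (r + 1)).lTensor (FQSym K) ∘ₗ comul K

/-- The operation induced on `FQSym^{⊗ r}` by the internal product, factor by factor. -/
noncomputable def internalTensor (r : ℕ) :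
    (⨂[K] _ : Fin r, FQSym K) →ₗ[K] (⨂[K] _ : Fin r, FQSym K) →ₗ[K] ⨂[K] _ : Fin r, FQSym K :=
  PiTensorProduct.map₂ fun _ => internal K

/-- The `r`-fold ordinary multiplication `μ_r : FQSym^{⊗ r} → FQSym`,
`x₁ ⊗ ⋯ ⊗ x_r ↦ x₁ ⋯ x_r`. -/
noncomputable def mulTensor (r : ℕ) : (⨂[K] _ : Fin r, FQSym K) →ₗ[K] FQSym K :=
  PiTensorProduct.lift (MultilinearMap.mkPiAlgebraFin K r (FQSym K))

attribute [local instance] LieRing.ofAssociativeRing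

/-- `Lie_n ⊆ K[𝔖_n]`: the elements which, when each permutation `σ` is read as the word
`x_{σ 0} x_{σ 1} ⋯ x_{σ (n-1)}`, lie in the free Lie algebra on `x_0, …, x_{n-1}`, i.e. in the Lie
subalgebra of the free associative algebra generated by the letters. -/
noncomputable def lieElements (n : ℕ) : Submodule K (Equiv.Perm (Fin n) →₀ K) :=
  (LieSubalgebra.lieSpan K (FreeAlgebra K (Fin n))
      (Set.range (FreeAlgebra.ι K))).toSubmodule.comap
    (Finsupp.linearCombination K fun σ : Equiv.Perm (Fin n) =>
      (List.ofFn fun i => FreeAlgebra.ι K (σ i)).prod)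

/-- The linear embedding `K[𝔖_n] → FQSym`, `σ ↦ G_σ`. -/
noncomputable def embed (n : ℕ) : (Equiv.Perm (Fin n) →₀ K) →ₗ[K] FQSym K :=
  Finsupp.linearCombination K fun σ : Equiv.Perm (Fin n) => G K σ

/-- The Patras–Reutenauer algebra: the span of all products `π_1 ⋯ π_s` where each `π_k` is in
the image of some `Lie_{j_k}` under `σ ↦ G_σ`, i.e. the subalgebra generated by these images. -/
noncomputable def patrasReutenauer : Subalgebra K (FQSym K) :=
  Algebra.adjoin K (⋃ n : ℕ, embed K n '' (lieElements K n : Set (Equiv.Perm (Fin n) →₀ K)))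

end FQSym

/-! Let `FQSym` act on the free associative algebra on letters indexed by ℕ by permuting places:
`G_σ` sends a word `w` of the right length to `w ∘ σ`. This action `place` is faithful
(`place_injective`); it turns the internal product into composition (`place_internal`) and the
ordinary product into convolution with respect to concatenation and the unshuffling coproduct δ
(`place_mul`).

Lie elements act with values in the primitive elements, so a generator π of the Patras–Reutenauer
algebra 𝒜 satisfies δ∘π = D∘δ with D = π⊗1 + 1⊗π. Since δ is coassociative and cocommutative, such
relations multiply (`Intertwines.mul`); hence every H in 𝒜 has some D in the image of 𝒜⊗𝒜 with δ∘H =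
D∘δ. Testing this on the words 0 1 ⋯ (k+l-1), with the letters `< k` kept on the left and the
letters `≥ k` on the right, forces D = ΔH (`Intertwines.eq_comul`).

The case r = 2 follows: (xy)*H acts as μ∘(x⊗y)∘δ∘H = μ∘(x⊗y)∘ΔH∘δ, which is the action of the
right-hand side (`internal_mul_left`). The general case is an induction on r, which can continue
because the tensor factors of ΔH may be taken in 𝒜 (`comul_mem`). -/

/-! ### Subwords and standardization -/

theorem prod_ofFn_ite_mem {M : Type*} [Monoid M] {n k : ℕ} (s : Finset (Fin n))
    (h : s.card = k) (f : Fin n → M) :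
    (List.ofFn fun i => if i ∈ s then f i else 1).prod =
      (List.ofFn fun j : Fin k => f (s.orderEmbOfFin h j)).prod := by
  -- Both lists are strictly increasing and have the same members.
  have key : (List.finRange n).filter (· ∈ s) = List.ofFn (s.orderEmbOfFin h) := by
    refine List.Perm.eq_of_pairwise (le := (· < ·)) ?_ ?_ ?_ ?_
    · intro a b _ _ h1 h2
      exact absurd h1 (not_lt_of_gt h2)
    · exact (List.pairwise_lt_finRange n).filter _
    · rw [List.pairwise_ofFn]
      intro i j hij
      exact (s.orderEmbOfFin h).strictMono hij
    · rw [List.perm_ext_iff_of_nodup ((List.nodup_finRange n).filter _)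
        (List.nodup_ofFn.2 (s.orderEmbOfFin h).injective)]
      intro a
      rw [List.mem_ofFn, ← Set.mem_range, Finset.range_orderEmbOfFin]
      simp
  have h2 : ∀ l : List (Fin n), (l.map fun i => if i ∈ s then f i else 1).prod =
      ((l.filter (· ∈ s)).map f).prod := by
    intro l
    induction l with
    | nil => simp
    | cons a l ih => by_cases ha : a ∈ s <;> simp [ha, ih]
  rw [List.ofFn_eq_map, h2, key, List.map_ofFn]
  rfl

/-- An injective word is recovered from its set of letters and its standardization; this drives the
bijection in `place_mul`. -/
theorem orderEmbOfFin_comp_std {m n : ℕ} {f : Fin m → Fin n} (hf : Function.Injective f)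
    {s : Finset (Fin n)} (h : s.card = m) (hs : ∀ i, f i ∈ s) (i : Fin m) :
    s.orderEmbOfFin h (std f i) = f i := by
  have : (fun i => f ((std f)⁻¹ i)) = s.orderEmbOfFin h := by
    refine Finset.orderEmbOfFin_unique h (fun x => hs _) ?_
    intro a b hab
    have := (std_lt_iff hf ((std f)⁻¹ a) ((std f)⁻¹ b)).1 (by simpa using hab)
    exact this
  rw [← this]
  simp

theorem std_orderEmb_comp {m n : ℕ} (f : Fin m ↪o Fin n) (α : Equiv.Perm (Fin m)) :
    std (fun i => f (α i)) = α :=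
  (std_eq_iff (f.injective.comp α.injective) α).2 fun i j => by simp

namespace FQSym

variable (K : Type*) [Field K]

/-! ### Words and the action by permutation of places -/

/-- The monomial of the free associative algebra read off a word. -/
noncomputable def word {n : ℕ} (w : Fin n → ℕ) : FreeAlgebra K ℕ :=
  (List.ofFn fun i => FreeAlgebra.ι K (w i)).prod

/-- The basis of the free associative algebra consisting of all words. -/
noncomputable def wordBasis : Module.Basis (Σ n : ℕ, Fin n → ℕ) K (FreeAlgebra K ℕ) :=
  (FreeAlgebra.basisFreeMonoid K ℕ).reindex (FreeMonoid.toList.trans List.equivSigmaTuple)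

theorem wordBasis_apply {n : ℕ} (w : Fin n → ℕ) : wordBasis K ⟨n, w⟩ = word K w := by
  have h : ∀ l : FreeMonoid ℕ, FreeAlgebra.basisFreeMonoid K ℕ l =
      (l.toList.map (FreeAlgebra.ι K)).prod := by
    intro l
    simp [FreeAlgebra.basisFreeMonoid, FreeAlgebra.equivMonoidAlgebraFreeMonoid, FreeMonoid.lift_apply]
  rw [wordBasis, Module.Basis.reindex_apply, h, word]
  change ((List.ofFn w).map _).prod = _
  rw [List.map_ofFn]
  rfl

theorem word_add {m n : ℕ} (w : Fin (m + n) → ℕ) :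
    word K w = word K (fun i => w (Fin.castAdd n i)) * word K (fun i => w (Fin.natAdd m i)) := by
  rw [word, List.ofFn_add, List.prod_append]
  rfl

theorem word_fin_zero (w : Fin 0 → ℕ) : word K w = 1 := by simp [word]

/-- The action of `FQSym` on the free associative algebra by permutation of places:
`G_σ` maps a word `w` of the same length as `σ` to `w ∘ σ`, and other words to `0`. -/
noncomputable def place : FQSym K →ₗ[K] FreeAlgebra K ℕ →ₗ[K] FreeAlgebra K ℕ :=
  (basisG K).constr K fun s => (wordBasis K).constr K fun t =>
    if h : s.1 = t.1 then word K (fun i => t.2 (Fin.cast h (s.2 i))) else 0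

theorem place_G_word {n : ℕ} (σ : Equiv.Perm (Fin n)) (w : Fin n → ℕ) :
    place K (G K σ) (word K w) = word K (fun i => w (σ i)) := by
  rw [← wordBasis_apply, place, G, Module.Basis.constr_basis, Module.Basis.constr_basis]
  simp

theorem place_G_word_of_ne {m n : ℕ} (h : m ≠ n) (σ : Equiv.Perm (Fin m)) (w : Fin n → ℕ) :
    place K (G K σ) (word K w) = 0 := by
  rw [← wordBasis_apply, place, G, Module.Basis.constr_basis, Module.Basis.constr_basis]
  simp [h]

theorem place_G_word_orderEmbOfFin {k N : ℕ} {s : Finset (Fin N)} (h : s.card = k)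
    (σ : Equiv.Perm (Fin k)) (w : Fin N → ℕ) :
    place K (G K σ) (word K fun i => w (s.orderEmbOfFin rfl i)) =
      word K (fun i => w (s.orderEmbOfFin h (σ i))) := by
  subst h
  rw [place_G_word]

theorem linearMap_ext_word {M : Type*} [AddCommGroup M] [Module K M]
    {f g : FreeAlgebra K ℕ →ₗ[K] M}
    (h : ∀ (n : ℕ) (w : Fin n → ℕ), f (word K w) = g (word K w)) : f = g :=
  (wordBasis K).ext fun ⟨n, w⟩ => by rw [wordBasis_apply, h]

theorem linearMap_ext_G {M : Type*} [AddCommGroup M] [Module K M] {f g : FQSym K →ₗ[K] M}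
    (h : ∀ (n : ℕ) (σ : Equiv.Perm (Fin n)), f (G K σ) = g (G K σ)) : f = g :=
  (basisG K).ext fun ⟨n, σ⟩ => h n σ

/-! ### Unshuffling, and how the two products of `FQSym` act -/

/-- The unshuffling coproduct of the free associative algebra. -/
noncomputable def unshuffle : FreeAlgebra K ℕ →ₐ[K] FreeAlgebra K ℕ ⊗[K] FreeAlgebra K ℕ :=
  FreeAlgebra.lift K fun x => FreeAlgebra.ι K x ⊗ₜ 1 + 1 ⊗ₜ FreeAlgebra.ι K x

theorem unshuffle_ι (x : ℕ) : unshuffle K (FreeAlgebra.ι K x) =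
    FreeAlgebra.ι K x ⊗ₜ 1 + 1 ⊗ₜ FreeAlgebra.ι K x := by
  simp [unshuffle]

theorem prod_ofFn_tmul {A B : Type*} [Ring A] [Algebra K A] [Ring B] [Algebra K B] {n : ℕ}
    (f : Fin n → A) (g : Fin n → B) :
    (List.ofFn fun i => f i ⊗ₜ[K] g i).prod = (List.ofFn f).prod ⊗ₜ[K] (List.ofFn g).prod := by
  induction n with
  | zero => simp [Algebra.TensorProduct.one_def]
  | succ n ih => simp [List.ofFn_succ, ih]

/-- Expand the product of the factors x⊗1 + 1⊗x: `s` is the set of places whose letter goes to the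
left. -/
theorem unshuffle_word {n : ℕ} (w : Fin n → ℕ) :
    unshuffle K (word K w) = ∑ s : Finset (Fin n),
      word K (fun i => w (s.orderEmbOfFin rfl i)) ⊗ₜ[K]
        word K (fun i => w (sᶜ.orderEmbOfFin rfl i)) := by
  have h := (MultilinearMap.mkPiAlgebraFin K n
    (FreeAlgebra K ℕ ⊗[K] FreeAlgebra K ℕ)).map_add_univ
    (fun i => FreeAlgebra.ι K (w i) ⊗ₜ[K] (1 : FreeAlgebra K ℕ))
    (fun i => (1 : FreeAlgebra K ℕ) ⊗ₜ[K] FreeAlgebra.ι K (w i))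
  rw [MultilinearMap.mkPiAlgebraFin_apply] at h
  rw [word, map_list_prod, List.map_ofFn]
  refine Eq.trans ?_ (h.trans (Finset.sum_congr rfl fun s _ => ?_))
  · congr 2
    funext i
    simp [unshuffle_ι]
  · rw [MultilinearMap.mkPiAlgebraFin_apply, word, word,
      ← prod_ofFn_ite_mem s rfl fun i => FreeAlgebra.ι K (w i),
      ← prod_ofFn_ite_mem sᶜ rfl fun i => FreeAlgebra.ι K (w i), ← prod_ofFn_tmul]
    congr 2
    funext i
    by_cases hi : i ∈ s <;> simp [hi]

/-- On `G_α`, `G_β` and a word of length m + n, only the subsets of m places contribute. Such a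
subset `s` corresponds to the permutation γ = u · v with std u = α, std v = β and letters of u
forming `s`. -/
theorem place_mul (x y : FQSym K) : place K (x * y) =
    LinearMap.mul' K _ ∘ₗ TensorProduct.map (place K x) (place K y) ∘ₗ
      (unshuffle K).toLinearMap := by
  suffices h : (mulLin K).compr₂ (place K) =
      ((TensorProduct.mapBilinear (RingHom.id K) _ _ _ _).compl₁₂ (place K) (place K)).compr₂
        ((LinearMap.mul' K (FreeAlgebra K ℕ)).compRight K ∘ₗ
          (LinearMap.lcomp K _ (unshuffle K).toLinearMap)) from
    LinearMap.congr_fun₂ h x y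
  refine linearMap_ext_G K fun m α => linearMap_ext_G K fun n β =>
    linearMap_ext_word K fun N w => ?_
  change place K (G K α * G K β) (word K w) = LinearMap.mul' K _
    (TensorProduct.map (place K (G K α)) (place K (G K β)) (unshuffle K (word K w)))
  rw [unshuffle_word, G_mul_G, map_sum, map_sum, map_sum, LinearMap.sum_apply]
  simp only [TensorProduct.map_tmul, LinearMap.mul'_apply]
  by_cases hN : N = m + n
  · subst hN
    have e1 : ∀ γ : Equiv.Perm (Fin (m + n)),
        place K (if std (fun i : Fin m => γ (Fin.castAdd n i)) = α ∧
          std (fun j : Fin n => γ (Fin.natAdd m j)) = β then G K γ else 0) (word K w) =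
        if std (fun i : Fin m => γ (Fin.castAdd n i)) = α ∧
          std (fun j : Fin n => γ (Fin.natAdd m j)) = β then word K (fun i => w (γ i)) else 0 := by
      intro γ
      split_ifs
      · exact place_G_word K γ w
      · simp
    have e2 : ∀ s : Finset (Fin (m + n)), s.card ≠ m →
        place K (G K α) (word K fun i => w (s.orderEmbOfFin rfl i)) *
          place K (G K β) (word K fun i => w (sᶜ.orderEmbOfFin rfl i)) = 0 := by
      intro s hs
      rw [place_G_word_of_ne K (Ne.symm hs), zero_mul]
    have e3 : ∀ s : Finset (Fin (m + n)), ∀ (h : s.card = m) (h' : sᶜ.card = n),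
        place K (G K α) (word K fun i => w (s.orderEmbOfFin rfl i)) *
          place K (G K β) (word K fun i => w (sᶜ.orderEmbOfFin rfl i)) =
        word K (fun i => w (s.orderEmbOfFin h (α i))) *
          word K (fun i => w (sᶜ.orderEmbOfFin h' (β i))) := by
      intro s h h'
      rw [place_G_word_orderEmbOfFin K h, place_G_word_orderEmbOfFin K h']
    have hc : ∀ s : Finset (Fin (m + n)), s.card = m → sᶜ.card = n := by
      intro s hs
      rw [Finset.card_compl, Fintype.card_fin]
      omega
    have hinj : ∀ γ : Equiv.Perm (Fin (m + n)),
        Function.Injective fun i : Fin m => γ (Fin.castAdd n i) :=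
      fun γ => γ.injective.comp (Fin.castAdd_injective _ _)
    have hinj' : ∀ γ : Equiv.Perm (Fin (m + n)),
        Function.Injective fun i : Fin n => γ (Fin.natAdd m i) :=
      fun γ => γ.injective.comp (Fin.natAdd_injective _ _)
    rw [Finset.sum_congr rfl fun γ _ => e1 γ, ← Finset.sum_filter,
      ← Finset.sum_filter_of_ne (p := fun s : Finset (Fin (m + n)) => s.card = m)
        (fun s _ h => not_imp_comm.1 (e2 s) h)]
    have hcard : ∀ γ : Equiv.Perm (Fin (m + n)),
        (Finset.univ.image fun i : Fin m => γ (Fin.castAdd n i)).card = m := by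
      intro γ
      rw [Finset.card_image_of_injective _ (hinj γ), Finset.card_fin]
    have hmem : ∀ (γ : Equiv.Perm (Fin (m + n))) (i : Fin m), γ (Fin.castAdd n i) ∈
        Finset.univ.image fun i : Fin m => γ (Fin.castAdd n i) := by
      intro γ i
      simp
    have hmem' : ∀ (γ : Equiv.Perm (Fin (m + n))) (i : Fin n), γ (Fin.natAdd m i) ∈
        (Finset.univ.image fun i : Fin m => γ (Fin.castAdd n i))ᶜ := by
      intro γ i
      simp [Fin.ext_iff]
      intro x
      have := x.2
      omega
    -- The bijection sends γ to the set of its first m values; the inverse arranges `s` according to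
    -- α and its complement according to β.
    refine Finset.sum_bij
      (fun γ _ => Finset.univ.image fun i : Fin m => γ (Fin.castAdd n i)) ?_ ?_ ?_ ?_
    · intro γ _
      simpa using hcard γ
    · intro γ hγ γ' hγ' h
      rw [Finset.mem_filter] at hγ hγ'
      ext i
      congr 1
      refine Fin.addCases (fun i => ?_) (fun i => ?_) i
      · rw [← orderEmbOfFin_comp_std (hinj γ) (hcard γ) (hmem γ) i,
          ← orderEmbOfFin_comp_std (hinj γ') (hcard γ') (hmem γ') i, hγ.2.1, hγ'.2.1]
        simp only [h]
      · rw [← orderEmbOfFin_comp_std (hinj' γ) (hc _ (hcard γ)) (hmem' γ) i,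
          ← orderEmbOfFin_comp_std (hinj' γ') (hc _ (hcard γ')) (hmem' γ') i, hγ.2.2, hγ'.2.2]
        simp only [h]
    · intro s hs
      have h : s.card = m := by simpa using hs
      have hi : Function.Injective (Fin.append (fun i => s.orderEmbOfFin h (α i))
          (fun i => sᶜ.orderEmbOfFin (hc s h) (β i))) := by
        rw [Fin.append_injective_iff]
        refine ⟨(s.orderEmbOfFin h).injective.comp α.injective,
          (sᶜ.orderEmbOfFin (hc s h)).injective.comp β.injective, fun i j hij => ?_⟩
        have h1 := s.orderEmbOfFin_mem h (α i)
        have h2 := sᶜ.orderEmbOfFin_mem (hc s h) (β j)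
        rw [← hij, Finset.mem_compl] at h2
        exact h2 h1
      refine ⟨Equiv.ofBijective _ (Finite.injective_iff_bijective.1 hi), ?_, ?_⟩
      · simp [std_orderEmb_comp]
      · refine Finset.eq_of_subset_of_card_le ?_ (by rw [hcard, h])
        intro x hx
        simp only [Finset.mem_image, Finset.mem_univ, true_and] at hx
        obtain ⟨i, rfl⟩ := hx
        simp
    · intro γ hγ
      rw [Finset.mem_filter] at hγ
      rw [e3 _ (hcard γ) (hc _ (hcard γ)), word_add, ← hγ.2.1, ← hγ.2.2]
      congr 2
      · funext i
        rw [orderEmbOfFin_comp_std (hinj γ) (hcard γ) (hmem γ) i]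
      · funext i
        rw [orderEmbOfFin_comp_std (hinj' γ) (hc _ (hcard γ)) (hmem' γ) i]
  · rw [Finset.sum_eq_zero, Finset.sum_eq_zero]
    · intro s _
      by_cases hs : m = s.card
      · rw [place_G_word_of_ne K (m := n), mul_zero]
        have h1 := s.card_add_card_compl
        rw [Fintype.card_fin] at h1
        omega
      · rw [place_G_word_of_ne K hs, zero_mul]
    · intro γ _
      split_ifs
      · exact place_G_word_of_ne K (Ne.symm hN) γ w
      · simp

/-- The order in `G_σ * G_τ = G_{τσ}` matches (w ∘ τ) ∘ σ = w ∘ (τσ). -/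
theorem place_internal (x y : FQSym K) :
    place K (internal K x y) = place K x ∘ₗ place K y := by
  suffices h : (internal K).compr₂ (place K) =
      (LinearMap.llcomp K (FreeAlgebra K ℕ) (FreeAlgebra K ℕ) (FreeAlgebra K ℕ)).compl₁₂
        (place K) (place K) from
    LinearMap.congr_fun₂ h x y
  refine linearMap_ext_G K fun m σ => linearMap_ext_G K fun n τ =>
    linearMap_ext_word K fun N w => ?_
  change place K (internal K (G K σ) (G K τ)) (word K w) =
    place K (G K σ) (place K (G K τ) (word K w))
  rw [internal, bilin_G]
  by_cases hn : n = N
  · subst hn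
    rw [place_G_word]
    split_ifs with h
    · subst h
      rw [place_G_word, place_G_word]
      rfl
    · rw [place_G_word_of_ne K h]
      simp
  · rw [place_G_word_of_ne K hn, map_zero]
    split_ifs with h
    · exact place_G_word_of_ne K hn _ w
    · simp

/-! ### The unit and the action on the tensor square -/

/-- The augmentation of the free associative algebra. -/
noncomputable def augmentation : FreeAlgebra K ℕ →ₐ[K] K := FreeAlgebra.lift K fun _ => 0

theorem augmentation_word_succ {n : ℕ} (w : Fin (n + 1) → ℕ) :
    augmentation K (word K w) = 0 := by
  simp [word, augmentation, List.ofFn_succ]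

theorem place_one : place K 1 =
    ((Algebra.ofId K (FreeAlgebra K ℕ)).comp (augmentation K)).toLinearMap := by
  refine linearMap_ext_word K fun n w => ?_
  rw [one_def, AlgHom.toLinearMap_apply]
  rcases n with - | n
  · rw [place_G_word, word_fin_zero, word_fin_zero, map_one]
  · rw [place_G_word_of_ne K (Nat.succ_ne_zero n).symm, AlgHom.comp_apply,
      augmentation_word_succ, map_zero]

/-- The factorwise action of `FQSym ⊗ FQSym` on the tensor square of the free algebra. -/
noncomputable def place₂ : FQSym K ⊗[K] FQSym K →ₗ[K]
    FreeAlgebra K ℕ ⊗[K] FreeAlgebra K ℕ →ₗ[K] FreeAlgebra K ℕ ⊗[K] FreeAlgebra K ℕ :=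
  TensorProduct.lift
    ((TensorProduct.mapBilinear (RingHom.id K) _ _ _ _).compl₁₂ (place K) (place K))

theorem place₂_tmul (x y : FQSym K) :
    place₂ K (x ⊗ₜ y) = TensorProduct.map (place K x) (place K y) := rfl

/-- This is the counit axiom for unshuffling, since `1` acts as the augmentation; both sides are
algebra morphisms, so letters suffice. -/
theorem map_id_place_one_comp_unshuffle :
    TensorProduct.map LinearMap.id (place K 1) ∘ₗ (unshuffle K).toLinearMap =
      (Algebra.TensorProduct.includeLeft :
        FreeAlgebra K ℕ →ₐ[K] FreeAlgebra K ℕ ⊗[K] FreeAlgebra K ℕ).toLinearMap := by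
  have h : (Algebra.TensorProduct.map (AlgHom.id K (FreeAlgebra K ℕ))
      ((Algebra.ofId K (FreeAlgebra K ℕ)).comp (augmentation K))).comp (unshuffle K) =
      Algebra.TensorProduct.includeLeft := by
    ext x
    simp [unshuffle_ι, augmentation]
  rw [place_one, ← h]
  rfl

theorem map_place_one_id_comp_unshuffle :
    TensorProduct.map (place K 1) LinearMap.id ∘ₗ (unshuffle K).toLinearMap =
      (Algebra.TensorProduct.includeRight :
        FreeAlgebra K ℕ →ₐ[K] FreeAlgebra K ℕ ⊗[K] FreeAlgebra K ℕ).toLinearMap := by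
  have h : (Algebra.TensorProduct.map ((Algebra.ofId K (FreeAlgebra K ℕ)).comp (augmentation K))
      (AlgHom.id K (FreeAlgebra K ℕ))).comp (unshuffle K) =
      Algebra.TensorProduct.includeRight := by
    ext x
    simp [unshuffle_ι, augmentation]
  rw [place_one, ← h]
  rfl

theorem place₂_tmul_one_unshuffle (x : FQSym K) (y : FreeAlgebra K ℕ) :
    place₂ K (x ⊗ₜ 1) (unshuffle K y) = place K x y ⊗ₜ 1 := by
  have h := LinearMap.congr_fun (map_id_place_one_comp_unshuffle K) y
  have h' := congrArg (TensorProduct.map (place K x) LinearMap.id) h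
  rw [LinearMap.comp_apply, ← LinearMap.comp_apply, ← TensorProduct.map_comp] at h'
  exact h'

theorem place₂_one_tmul_unshuffle (x : FQSym K) (y : FreeAlgebra K ℕ) :
    place₂ K (1 ⊗ₜ x) (unshuffle K y) = 1 ⊗ₜ place K x y := by
  have h := LinearMap.congr_fun (map_place_one_id_comp_unshuffle K) y
  have h' := congrArg (TensorProduct.map LinearMap.id (place K x)) h
  rw [LinearMap.comp_apply, ← LinearMap.comp_apply, ← TensorProduct.map_comp] at h'
  exact h'

/-! ### Intertwining with the unshuffling coproduct: Lie elements -/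

/-- `H` is compatible with the unshuffling coproduct through `D`: acting by `H` and unshuffling
is the same as unshuffling and acting by `D`. -/
def Intertwines (H : FQSym K) (D : FQSym K ⊗[K] FQSym K) : Prop :=
  ∀ y, unshuffle K (place K H y) = place₂ K D (unshuffle K y)

attribute [local instance] LieRing.ofAssociativeRing

/-- The primitive elements of the free associative algebra. -/
noncomputable def primitives : LieSubalgebra K (FreeAlgebra K ℕ) where
  carrier := {y | unshuffle K y = y ⊗ₜ 1 + 1 ⊗ₜ y}
  zero_mem' := by simp
  add_mem' {a b} ha hb := by
    simp only [Set.mem_ofPred_eq] at *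
    rw [map_add, ha, hb, TensorProduct.add_tmul, TensorProduct.tmul_add]
    abel
  smul_mem' c a ha := by
    simp only [Set.mem_ofPred_eq] at *
    rw [map_smul, ha, smul_add, TensorProduct.smul_tmul', TensorProduct.tmul_smul]
  lie_mem' {a b} ha hb := by
    simp only [Set.mem_ofPred_eq, LieRing.of_associative_ring_bracket] at *
    have ha' : unshuffle K a = a ⊗ₜ 1 + 1 ⊗ₜ a := ha
    have hb' : unshuffle K b = b ⊗ₜ 1 + 1 ⊗ₜ b := hb
    rw [map_sub, map_mul, map_mul, ha', hb', TensorProduct.sub_tmul, TensorProduct.tmul_sub]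
    -- The cross terms a⊗b and b⊗a cancel in the commutator.
    simp only [mul_add, add_mul, Algebra.TensorProduct.tmul_mul_tmul, one_mul, mul_one]
    abel

/-- Acting on `w` amounts to substituting the letters of `w` for the variables of the polynomial
encoded by π. -/
theorem place_embed_word {n : ℕ} (π : Equiv.Perm (Fin n) →₀ K) (w : Fin n → ℕ) :
    place K (embed K n π) (word K w) = FreeAlgebra.lift K (fun i => FreeAlgebra.ι K (w i))
      (Finsupp.linearCombination K (fun σ : Equiv.Perm (Fin n) =>
        (List.ofFn fun i => FreeAlgebra.ι K (σ i)).prod) π) := by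
  induction π using Finsupp.induction_linear with
  | zero => simp
  | add f g hf hg => simp only [map_add, LinearMap.add_apply, hf, hg]
  | single σ c =>
    rw [embed, Finsupp.linearCombination_single, Finsupp.linearCombination_single, map_smul,
      map_smul, LinearMap.smul_apply, place_G_word, map_list_prod, List.map_ofFn,
      word]
    congr 3
    funext i
    simp

theorem place_embed_word_of_ne {m n : ℕ} (h : m ≠ n) (π : Equiv.Perm (Fin m) →₀ K)
    (w : Fin n → ℕ) : place K (embed K m π) (word K w) = 0 := by
  induction π using Finsupp.induction_linear with
  | zero => simp
  | add f g hf hg => simp only [map_add, LinearMap.add_apply, hf, hg, add_zero]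
  | single σ c =>
    rw [embed, Finsupp.linearCombination_single, map_smul, LinearMap.smul_apply,
      place_G_word_of_ne K h, smul_zero]

/-- Substituting letters into a Lie polynomial gives a Lie polynomial in letters; letters are
primitive and primitives form a Lie subalgebra. Words of other lengths are killed. -/
theorem place_embed_mem_primitives {n : ℕ} {π : Equiv.Perm (Fin n) →₀ K}
    (hπ : π ∈ lieElements K n) (y : FreeAlgebra K ℕ) :
    place K (embed K n π) y ∈ primitives K := by
  have hy := (wordBasis K).mem_span y
  induction hy using Submodule.span_induction with
  | zero => simp
  | add a b _ _ ha hb => rw [map_add]; exact add_mem ha hb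
  | smul c a _ ha => rw [map_smul]; exact (primitives K).smul_mem c ha
  | mem y hy =>
    obtain ⟨⟨N, w⟩, rfl⟩ := hy
    rw [wordBasis_apply]
    by_cases h : n = N
    · subst h
      rw [place_embed_word]
      have hle : LieSubalgebra.lieSpan K (FreeAlgebra K (Fin n)) (Set.range (FreeAlgebra.ι K)) ≤
          (primitives K).comap
            ((FreeAlgebra.lift K fun i => FreeAlgebra.ι K (w i)).toLieHom) := by
        rw [LieSubalgebra.lieSpan_le]
        rintro _ ⟨i, rfl⟩
        change FreeAlgebra.lift K (fun i => FreeAlgebra.ι K (w i)) (FreeAlgebra.ι K i) ∈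
          primitives K
        rw [FreeAlgebra.lift_ι_apply]
        exact unshuffle_ι K (w i)
      exact hle hπ
    · rw [place_embed_word_of_ne K h]
      exact zero_mem _

theorem intertwines_embed {n : ℕ} {π : Equiv.Perm (Fin n) →₀ K} (hπ : π ∈ lieElements K n) :
    Intertwines K (embed K n π) (embed K n π ⊗ₜ 1 + 1 ⊗ₜ embed K n π) := by
  intro y
  rw [map_add, LinearMap.add_apply, place₂_tmul_one_unshuffle, place₂_one_tmul_unshuffle]
  exact place_embed_mem_primitives K hπ y

theorem intertwines_one : Intertwines K 1 1 := by
  intro y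
  rw [Algebra.TensorProduct.one_def, place₂_tmul_one_unshuffle, place_one,
    AlgHom.toLinearMap_apply, AlgHom.comp_apply, Algebra.ofId_apply, AlgHom.commutes,
    Algebra.TensorProduct.algebraMap_apply]

theorem Intertwines.add {H H' : FQSym K} {D D' : FQSym K ⊗[K] FQSym K}
    (h : Intertwines K H D) (h' : Intertwines K H' D') : Intertwines K (H + H') (D + D') := by
  intro y
  simp only [map_add, LinearMap.add_apply, h y, h' y]

theorem Intertwines.smul (c : K) {H : FQSym K} {D : FQSym K ⊗[K] FQSym K}
    (h : Intertwines K H D) : Intertwines K (c • H) (c • D) := by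
  intro y
  simp only [map_smul, LinearMap.smul_apply, h y]

/-! ### Intertwining with the unshuffling coproduct: products -/

/-- Coassociativity and cocommutativity in one identity: the fourfold unshuffle is invariant under
exchanging its middle factors. Both sides are algebra morphisms, compared on letters. -/
theorem tensorComm_unshuffle (y : FreeAlgebra K ℕ) :
    TensorProduct.tensorTensorTensorComm K _ _ _ _ (TensorProduct.map (unshuffle K).toLinearMap
      (unshuffle K).toLinearMap (unshuffle K y)) =
    TensorProduct.map (unshuffle K).toLinearMap (unshuffle K).toLinearMap (unshuffle K y) := by
  have h : ((Algebra.TensorProduct.tensorTensorTensorComm K K K K (FreeAlgebra K ℕ)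
      (FreeAlgebra K ℕ) (FreeAlgebra K ℕ) (FreeAlgebra K ℕ)).toAlgHom.comp
      (Algebra.TensorProduct.map (unshuffle K) (unshuffle K))).comp (unshuffle K) =
      (Algebra.TensorProduct.map (unshuffle K) (unshuffle K)).comp (unshuffle K) := by
    ext x
    simp [unshuffle_ι, Algebra.TensorProduct.one_def, TensorProduct.add_tmul,
      TensorProduct.tmul_add]
    abel
  exact DFunLike.congr_fun h y

/-- For D = a⊗b and D' = c⊗d, the left side lets a, c, b, d act in this order on the fourfold
unshuffle, the right side a, b, c, d; the exchange of middle factors is absorbed by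
`tensorComm_unshuffle`. -/
theorem place₂_mul_unshuffle (D D' : FQSym K ⊗[K] FQSym K) (y : FreeAlgebra K ℕ) :
    place₂ K (D * D') (unshuffle K y) = LinearMap.mul' K _ (TensorProduct.map (place₂ K D)
      (place₂ K D') (TensorProduct.map (unshuffle K).toLinearMap (unshuffle K).toLinearMap
        (unshuffle K y))) := by
  induction D using TensorProduct.induction_on with
  | zero => simp
  | add D E hD hE =>
    rw [add_mul, map_add, LinearMap.add_apply, hD, hE, map_add, TensorProduct.map_add_left,
      LinearMap.add_apply, map_add]
  | tmul a b =>
  induction D' using TensorProduct.induction_on with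
  | zero => simp
  | add D E hD hE =>
    rw [mul_add, map_add, LinearMap.add_apply, hD, hE, map_add, TensorProduct.map_add_right,
      LinearMap.add_apply, map_add]
  | tmul c d =>
  have h : (TensorProduct.tensorTensorTensorComm K (FreeAlgebra K ℕ) (FreeAlgebra K ℕ)
      (FreeAlgebra K ℕ) (FreeAlgebra K ℕ)).toLinearMap ∘ₗ
      TensorProduct.map (place₂ K (a ⊗ₜ b)) (place₂ K (c ⊗ₜ d)) =
      TensorProduct.map (TensorProduct.map (place K a) (place K c))
        (TensorProduct.map (place K b) (place K d)) ∘ₗ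
          (TensorProduct.tensorTensorTensorComm K _ _ _ _).toLinearMap :=
    TensorProduct.ext_fourfold' fun _ _ _ _ => rfl
  have h' := LinearMap.congr_fun h (TensorProduct.map (unshuffle K).toLinearMap
    (unshuffle K).toLinearMap (unshuffle K y))
  simp only [LinearMap.comp_apply, LinearEquiv.coe_coe, tensorComm_unshuffle] at h'
  rw [LinearMap.mul'_tensor, LinearMap.comp_apply, LinearEquiv.coe_coe, h',
    Algebra.TensorProduct.tmul_mul_tmul, place₂_tmul, place_mul, place_mul,
    TensorProduct.map_comp, TensorProduct.map_comp]
  rfl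

/-- Unshuffling is multiplicative, so it passes through the convolution that describes `H * H'`; the
two hypotheses then apply factor by factor. -/
theorem Intertwines.mul {H H' : FQSym K} {D D' : FQSym K ⊗[K] FQSym K}
    (h : Intertwines K H D) (h' : Intertwines K H' D') : Intertwines K (H * H') (D * D') := by
  intro y
  rw [place₂_mul_unshuffle, place_mul]
  have h1 : (unshuffle K).toLinearMap ∘ₗ LinearMap.mul' K (FreeAlgebra K ℕ) =
      LinearMap.mul' K _ ∘ₗ
        TensorProduct.map (unshuffle K).toLinearMap (unshuffle K).toLinearMap := by
    refine TensorProduct.ext' fun a b => ?_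
    simp
  have h2 : ∀ {H : FQSym K} {D}, Intertwines K H D →
      (unshuffle K).toLinearMap ∘ₗ place K H = place₂ K D ∘ₗ (unshuffle K).toLinearMap :=
    fun h => LinearMap.ext h
  refine (LinearMap.congr_fun h1 _).trans ?_
  rw [LinearMap.comp_apply]
  congr 1
  change (TensorProduct.map _ _ ∘ₗ TensorProduct.map _ _) _ =
    (TensorProduct.map _ _ ∘ₗ TensorProduct.map _ _) _
  rw [← TensorProduct.map_comp, ← TensorProduct.map_comp, h2 h, h2 h']
  rfl

/-- The image of `𝒜 ⊗ 𝒜` in `FQSym ⊗ FQSym`, for `𝒜` the Patras–Reutenauer algebra. -/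
noncomputable def patrasReutenauer₂ : Subalgebra K (FQSym K ⊗[K] FQSym K) :=
  (Algebra.TensorProduct.map (patrasReutenauer K).val (patrasReutenauer K).val).range

theorem tmul_mem_patrasReutenauer₂ {x y : FQSym K} (hx : x ∈ patrasReutenauer K)
    (hy : y ∈ patrasReutenauer K) : x ⊗ₜ[K] y ∈ patrasReutenauer₂ K :=
  ⟨⟨x, hx⟩ ⊗ₜ ⟨y, hy⟩, rfl⟩

/-- Induction over the generated subalgebra. That `D` lies in the image of 𝒜⊗𝒜 is recorded for the
later induction on r. -/
theorem exists_intertwines {H : FQSym K} (hH : H ∈ patrasReutenauer K) :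
    ∃ D ∈ patrasReutenauer₂ K, Intertwines K H D := by
  induction hH using Algebra.adjoin_induction with
  | mem x hx =>
    have hx' : x ∈ patrasReutenauer K := Algebra.subset_adjoin hx
    simp only [Set.mem_iUnion, Set.mem_image] at hx
    obtain ⟨n, π, hπ, rfl⟩ := hx
    exact ⟨_, add_mem (tmul_mem_patrasReutenauer₂ K hx' (one_mem _))
      (tmul_mem_patrasReutenauer₂ K (one_mem _) hx'), intertwines_embed K hπ⟩
  | algebraMap c =>
    rw [Algebra.algebraMap_eq_smul_one]
    exact ⟨c • 1, Subalgebra.smul_mem _ (one_mem _) c, (intertwines_one K).smul K c⟩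
  | add x y _ _ hx hy =>
    obtain ⟨D, hD, h⟩ := hx
    obtain ⟨D', hD', h'⟩ := hy
    exact ⟨_, add_mem hD hD', h.add K h'⟩
  | mul x y _ _ hx hy =>
    obtain ⟨D, hD, h⟩ := hx
    obtain ⟨D', hD', h'⟩ := hy
    exact ⟨_, mul_mem hD hD', h.mul K h'⟩

/-! ### Faithfulness of the actions -/

/-- The word `0 1 ⋯ (n-1)`. -/
noncomputable def idWord (n : ℕ) : FreeAlgebra K ℕ := word K fun i : Fin n => (i : ℕ)

theorem place_G_idWord {n : ℕ} (σ : Equiv.Perm (Fin n)) :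
    place K (G K σ) (idWord K n) = word K fun i => (σ i : ℕ) :=
  place_G_word K σ _

theorem coord_G (p q : Σ n : ℕ, Equiv.Perm (Fin n)) :
    (wordBasis K).coord ⟨p.1, fun i => p.2 i⟩ (place K (basisG K q) (idWord K p.1)) =
      (basisG K).coord p (basisG K q) := by
  obtain ⟨m, σ⟩ := p
  obtain ⟨n, τ⟩ := q
  change (wordBasis K).coord _ (place K (G K τ) (idWord K m)) = _
  by_cases h : n = m
  · subst h
    rw [place_G_idWord, ← wordBasis_apply, Module.Basis.coord_apply, Module.Basis.coord_apply,
      Module.Basis.repr_self, Module.Basis.repr_self, Finsupp.single_apply, Finsupp.single_apply]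
    congr 1
    simp only [Sigma.mk.injEq, heq_eq_eq, true_and, eq_iff_iff]
    constructor
    · intro h
      ext i
      exact congrFun h i
    · rintro rfl
      rfl
  · rw [idWord, place_G_word_of_ne K h, map_zero, Module.Basis.coord_apply,
      Module.Basis.repr_self, Finsupp.single_apply, if_neg]
    rintro ⟨⟩
    exact h rfl

/-- Acting on the identity word reads off coefficients, because `G_σ` produces the word σ itself. -/
theorem coord_place (p : Σ n : ℕ, Equiv.Perm (Fin n)) (x : FQSym K) :
    (wordBasis K).coord ⟨p.1, fun i => p.2 i⟩ (place K x (idWord K p.1)) =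
      (basisG K).coord p x := by
  have h : (wordBasis K).coord ⟨p.1, fun i => p.2 i⟩ ∘ₗ
      (LinearMap.applyₗ (idWord K p.1)) ∘ₗ place K = (basisG K).coord p :=
    (basisG K).ext fun q => coord_G K p q
  exact LinearMap.congr_fun h x

theorem place_injective : Function.Injective (place K) := by
  intro x y h
  refine (basisG K).ext_elem fun p => ?_
  have := coord_place K p x
  rw [h, coord_place] at this
  exact this.symm

theorem eq_of_place₂_idWord {D D' : FQSym K ⊗[K] FQSym K}
    (h : ∀ k l : ℕ, place₂ K D (idWord K k ⊗ₜ idWord K l) =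
      place₂ K D' (idWord K k ⊗ₜ idWord K l)) : D = D' := by
  refine ((basisG K).tensorProduct (basisG K)).ext_elem fun ⟨p, q⟩ => ?_
  have key : ((wordBasis K).tensorProduct (wordBasis K)).coord
      (⟨p.1, fun i => p.2 i⟩, ⟨q.1, fun i => q.2 i⟩) ∘ₗ
      (LinearMap.applyₗ (idWord K p.1 ⊗ₜ idWord K q.1)) ∘ₗ place₂ K =
      ((basisG K).tensorProduct (basisG K)).coord (p, q) := by
    refine TensorProduct.ext' fun x y => ?_
    change ((wordBasis K).tensorProduct (wordBasis K)).repr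
      (place K x (idWord K p.1) ⊗ₜ place K y (idWord K q.1)) _ =
      ((basisG K).tensorProduct (basisG K)).repr (x ⊗ₜ y) (p, q)
    rw [Module.Basis.tensorProduct_repr_tmul_apply, Module.Basis.tensorProduct_repr_tmul_apply]
    have h1 := coord_place K p x
    have h2 := coord_place K q y
    simp only [Module.Basis.coord_apply] at h1 h2
    rw [h1, h2]
  have h1 := LinearMap.congr_fun key D
  have h2 := LinearMap.congr_fun key D'
  simp only [LinearMap.comp_apply, LinearMap.applyₗ_apply_apply, h p.1 q.1] at h1 h2
  exact h1.symm.trans h2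

/-! ### Splitting words by the size of their letters -/

/-- Replacing letters by letters preserves length and commutes with permuting places; a letter sent
to `0` kills the word whatever its place. -/
theorem lift_comp_place (f : ℕ → FreeAlgebra K ℕ)
    (hf : ∀ x, f x = 0 ∨ ∃ y, f x = FreeAlgebra.ι K y) (x : FQSym K) :
    (FreeAlgebra.lift K f).toLinearMap ∘ₗ place K x =
      place K x ∘ₗ (FreeAlgebra.lift K f).toLinearMap := by
  suffices h : (place K).compr₂ (FreeAlgebra.lift K f).toLinearMap =
      (place K).compl₂ (FreeAlgebra.lift K f).toLinearMap from LinearMap.congr_fun h x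
  refine linearMap_ext_G K fun n σ => linearMap_ext_word K fun N w => ?_
  change FreeAlgebra.lift K f (place K (G K σ) (word K w)) =
    place K (G K σ) (FreeAlgebra.lift K f (word K w))
  have hl : ∀ {k : ℕ} (v : Fin k → ℕ), FreeAlgebra.lift K f (word K v) =
      (List.ofFn fun i => f (v i)).prod := by
    intro k v
    rw [word, map_list_prod, List.map_ofFn]
    congr 2
    funext i
    simp
  by_cases hn : n = N
  · subst hn
    rw [place_G_word, hl, hl]
    by_cases h0 : ∃ i, f (w i) = 0
    · obtain ⟨i, hi⟩ := h0
      rw [List.prod_eq_zero, List.prod_eq_zero, map_zero]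
      · exact List.mem_ofFn.2 ⟨i, hi⟩
      · exact List.mem_ofFn.2 ⟨σ⁻¹ i, by simpa using hi⟩
    · push Not at h0
      choose w' hw' using fun i => (hf (w i)).resolve_left (h0 i)
      simp only [hw']
      exact (place_G_word K σ w').symm
  · rw [place_G_word_of_ne K hn, map_zero, hl]
    by_cases h0 : ∃ i, f (w i) = 0
    · obtain ⟨i, hi⟩ := h0
      rw [List.prod_eq_zero, map_zero]
      exact List.mem_ofFn.2 ⟨i, hi⟩
    · push Not at h0
      choose w' hw' using fun i => (hf (w i)).resolve_left (h0 i)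
      simp only [hw']
      exact (place_G_word_of_ne K hn σ w').symm

/-- The substitution which deletes the letters `≥ k`. -/
noncomputable def lowLetters (k : ℕ) : FreeAlgebra K ℕ →ₐ[K] FreeAlgebra K ℕ :=
  FreeAlgebra.lift K fun x => if x < k then FreeAlgebra.ι K x else 0

/-- The substitution which deletes the letters `< k` and shifts the others by `-k`. -/
noncomputable def highLetters (k : ℕ) : FreeAlgebra K ℕ →ₐ[K] FreeAlgebra K ℕ :=
  FreeAlgebra.lift K fun x => if x < k then 0 else FreeAlgebra.ι K (x - k)

/-- Splitting each word into its subword of letters `< k` and its subword of letters `≥ k`. -/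
noncomputable def splitLetters (k : ℕ) :
    FreeAlgebra K ℕ →ₐ[K] FreeAlgebra K ℕ ⊗[K] FreeAlgebra K ℕ :=
  (Algebra.TensorProduct.map (lowLetters K k) (highLetters K k)).comp (unshuffle K)

theorem splitLetters_ι (k x : ℕ) : splitLetters K k (FreeAlgebra.ι K x) =
    (if x < k then FreeAlgebra.ι K x else 1) ⊗ₜ
      (if k ≤ x then FreeAlgebra.ι K (x - k) else 1) := by
  by_cases h : x < k
  · simp [splitLetters, unshuffle_ι, lowLetters, highLetters, h, not_le.2 h]
  · simp [splitLetters, unshuffle_ι, lowLetters, highLetters, h, not_lt.1 h]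

theorem splitLetters_word {n : ℕ} (k : ℕ) (w : Fin n → ℕ) : splitLetters K k (word K w) =
    (List.ofFn fun i => if w i < k then FreeAlgebra.ι K (w i) else 1).prod ⊗ₜ
      (List.ofFn fun i => if k ≤ w i then FreeAlgebra.ι K (w i - k) else 1).prod := by
  rw [word, map_list_prod, List.map_ofFn, ← prod_ofFn_tmul]
  congr 2
  funext i
  simp [splitLetters_ι]

theorem splitLetters_place {H : FQSym K} {D : FQSym K ⊗[K] FQSym K} (h : Intertwines K H D)
    (k : ℕ) (y : FreeAlgebra K ℕ) :
    splitLetters K k (place K H y) = place₂ K D (splitLetters K k y) := by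
  rw [splitLetters, AlgHom.comp_apply, AlgHom.comp_apply, h y]
  -- The remaining commutation holds on the whole tensor square, not only on unshuffled elements.
  generalize unshuffle K y = z
  clear h
  suffices hz : (Algebra.TensorProduct.map (lowLetters K k) (highLetters K k)).toLinearMap ∘ₗ
      place₂ K D = place₂ K D ∘ₗ
        (Algebra.TensorProduct.map (lowLetters K k) (highLetters K k)).toLinearMap from
    LinearMap.congr_fun hz z
  refine TensorProduct.ext' fun u v => ?_
  induction D using TensorProduct.induction_on with
  | zero => simp
  | add D E hD hE =>
    simp only [map_add, LinearMap.comp_add, LinearMap.add_comp, LinearMap.add_apply, hD, hE]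
  | tmul a b =>
    have hl := LinearMap.congr_fun (lift_comp_place K
      (fun x => if x < k then FreeAlgebra.ι K x else 0)
      (fun x => by by_cases hx : x < k <;> simp [hx]) a) u
    have hr := LinearMap.congr_fun (lift_comp_place K
      (fun x => if x < k then 0 else FreeAlgebra.ι K (x - k))
      (fun x => by by_cases hx : x < k <;> simp [hx]) b) v
    exact congrArg₂ (· ⊗ₜ[K] ·) hl hr

theorem splitLetters_idWord (k l : ℕ) :
    splitLetters K k (idWord K (k + l)) = idWord K k ⊗ₜ idWord K l := by
  have h : ∀ i : Fin k, ¬ k ≤ (i : ℕ) := fun i => not_le.2 i.2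
  rw [idWord, word_add, map_mul, splitLetters_word, splitLetters_word]
  simp [idWord, word, h]

/-- This links unshuffling to the coproduct of `FQSym`: splitting the word σ at the value `k` gives
one summand of Δ`G_σ`. -/
theorem splitLetters_perm {n : ℕ} (σ : Equiv.Perm (Fin n)) (k : Fin (n + 1)) :
    splitLetters K k (word K fun i => (σ i : ℕ)) =
      (word K fun i => (lowPart σ k i : ℕ)) ⊗ₜ (word K fun i => (highPart σ k i : ℕ)) := by
  have hk := k.2
  have hlow : (Finset.univ.filter fun i => (σ i : ℕ) < k).card = k := by
    rw [Finset.card_equiv σ (t := Finset.univ.filter fun i : Fin n => (i : ℕ) < k) (by simp),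
      Fin.card_filter_val_lt]
    omega
  rw [splitLetters_word, word, word]
  congr 1
  · have hs := hlow
    have hinj : Function.Injective fun c : Fin k => σ⁻¹ ⟨c, by omega⟩ :=
      σ⁻¹.injective.comp fun a b hab => Fin.ext (by simpa using hab)
    have h1 := prod_ofFn_ite_mem _ hs fun i => FreeAlgebra.ι K (σ i : ℕ)
    simp only [Finset.mem_filter, Finset.mem_univ, true_and] at h1
    rw [h1]
    congr 2
    funext j
    -- `lowPart σ k` is inverse to the standardization of the list of positions, so the `j`-th
    -- position carrying a letter `< k` carries the letter `lowPart σ k j`.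
    have h2 := orderEmbOfFin_comp_std hinj hs (by simp) (lowPart σ k j)
    have h3 : std _ (lowPart σ k j) = j := Equiv.symm_apply_apply _ _
    rw [h3] at h2
    rw [h2]
    simp
  · have hs : (Finset.univ.filter fun i => (k : ℕ) ≤ σ i).card = n - k := by
      have h := Finset.card_filter_add_card_filter_not (s := (Finset.univ : Finset (Fin n)))
        fun i => (σ i : ℕ) < k
      simp only [not_lt, Finset.card_fin, hlow] at h
      omega
    have hinj : Function.Injective fun c : Fin (n - k) => σ⁻¹ ⟨k + c, by omega⟩ :=
      σ⁻¹.injective.comp fun a b hab => Fin.ext (by simpa using hab)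
    have h1 := prod_ofFn_ite_mem _ hs fun i => FreeAlgebra.ι K (σ i - k : ℕ)
    simp only [Finset.mem_filter, Finset.mem_univ, true_and] at h1
    rw [h1]
    congr 2
    funext j
    have h2 := orderEmbOfFin_comp_std hinj hs (by simp) (highPart σ k j)
    have h3 : std _ (highPart σ k j) = j := Equiv.symm_apply_apply _ _
    rw [h3] at h2
    rw [h2]
    simp

/-! ### Identification of the intertwiner with the coproduct -/

/-- For `H = G_σ` of degree k + l only the cut at `k` has factors of the right degrees; in any other
degree both sides vanish. -/
theorem place₂_comul_idWord (H : FQSym K) (k l : ℕ) :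
    place₂ K (comul K H) (idWord K k ⊗ₜ idWord K l) =
      splitLetters K k (place K H (idWord K (k + l))) := by
  suffices h : (LinearMap.applyₗ (idWord K k ⊗ₜ idWord K l)) ∘ₗ place₂ K ∘ₗ comul K =
      (splitLetters K k).toLinearMap ∘ₗ (LinearMap.applyₗ (idWord K (k + l))) ∘ₗ place K from
    LinearMap.congr_fun h H
  refine linearMap_ext_G K fun n σ => ?_
  change place₂ K (comul K (basisG K ⟨n, σ⟩)) (idWord K k ⊗ₜ idWord K l) =
      splitLetters K k (place K (G K σ) (idWord K (k + l)))
  rw [comul, Module.Basis.constr_basis, map_sum, LinearMap.sum_apply]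
  simp only [place₂_tmul, TensorProduct.map_tmul]
  by_cases hn : n = k + l
  · rw [Finset.sum_eq_single ⟨k, by omega⟩]
    · obtain rfl : l = n - k := by omega
      have h1 := splitLetters_perm K σ ⟨k, by omega⟩
      have h2 : idWord K (k + (n - k)) = idWord K n := by rw [← hn]
      rw [h2, place_G_idWord K σ]
      refine Eq.trans ?_ h1.symm
      rw [idWord, idWord]
      exact congrArg₂ (· ⊗ₜ[K] ·) (place_G_word K _ _) (place_G_word K _ _)
    · intro j _ hj
      rw [idWord, place_G_word_of_ne K, TensorProduct.zero_tmul]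
      intro h
      exact hj (Fin.ext h)
    · simp
  · rw [idWord, idWord, idWord, place_G_word_of_ne K hn, map_zero, Finset.sum_eq_zero]
    intro j _
    by_cases hj : (j : ℕ) = k
    · rw [place_G_word_of_ne K (m := n - j), TensorProduct.tmul_zero]
      have := j.2
      omega
    · rw [place_G_word_of_ne K hj, TensorProduct.zero_tmul]

/-- Splitting letters commutes with the actions and sends the identity word to a tensor of identity
words, on which elements of `FQSym ⊗ FQSym` are determined. -/
theorem Intertwines.eq_comul {H : FQSym K} {D : FQSym K ⊗[K] FQSym K}
    (h : Intertwines K H D) : D = comul K H := by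
  refine eq_of_place₂_idWord K fun k l => ?_
  rw [place₂_comul_idWord, splitLetters_place K h, splitLetters_idWord]

theorem intertwines_comul {H : FQSym K} (hH : H ∈ patrasReutenauer K) :
    Intertwines K H (comul K H) := by
  obtain ⟨D, -, h⟩ := exists_intertwines K hH
  rwa [← h.eq_comul]

theorem comul_mem {H : FQSym K} (hH : H ∈ patrasReutenauer K) :
    comul K H ∈ patrasReutenauer₂ K := by
  obtain ⟨D, hD, h⟩ := exists_intertwines K hH
  rwa [← h.eq_comul]

/-! ### The splitting formula and its iteration -/

theorem internal_mul_left (x y : FQSym K) {H : FQSym K} (hH : H ∈ patrasReutenauer K) :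
    internal K (x * y) H = LinearMap.mul' K (FQSym K)
      (TensorProduct.map (internal K x) (internal K y) (comul K H)) := by
  apply place_injective K
  -- Valid for every `D`; membership in 𝒜 enters only through `intertwines_comul`.
  have key : ∀ D : FQSym K ⊗[K] FQSym K, place K (LinearMap.mul' K (FQSym K)
      (TensorProduct.map (internal K x) (internal K y) D)) =
      LinearMap.mul' K _ ∘ₗ TensorProduct.map (place K x) (place K y) ∘ₗ place₂ K D ∘ₗ
        (unshuffle K).toLinearMap := by
    intro D
    induction D using TensorProduct.induction_on with
    | zero => simp
    | add D E hD hE =>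
      simp only [map_add, hD, hE, LinearMap.comp_add, LinearMap.add_comp]
    | tmul a b =>
      rw [TensorProduct.map_tmul, LinearMap.mul'_apply, place_mul, place_internal,
        place_internal, TensorProduct.map_comp]
      rfl
  rw [key, place_internal, place_mul]
  refine LinearMap.ext fun z => ?_
  simp only [LinearMap.comp_apply, AlgHom.toLinearMap_apply, intertwines_comul K hH z]

theorem mulTensor_internalTensor_consTensor {r : ℕ} (F : Fin (r + 1) → FQSym K) (a : FQSym K)
    (t : ⨂[K] _ : Fin r, FQSym K) :
    mulTensor K (r + 1) (internalTensor K (r + 1) (PiTensorProduct.tprod K F)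
      (consTensor K r (a ⊗ₜ t))) =
    internal K (F 0) a *
      mulTensor K r (internalTensor K r (PiTensorProduct.tprod K fun i => F i.succ) t) := by
  induction t using PiTensorProduct.induction_on with
  | smul_tprod c g =>
    rw [TensorProduct.tmul_smul]
    simp only [map_smul, mul_smul_comm]
    congr 1
    have h1 : consTensor K r (a ⊗ₜ PiTensorProduct.tprod K g) =
        PiTensorProduct.tprod K (Fin.cons a g : Fin (r + 1) → FQSym K) := by
      simp [consTensor]
    rw [h1, internalTensor, internalTensor, PiTensorProduct.map₂_tprod_tprod,
      PiTensorProduct.map₂_tprod_tprod, mulTensor, mulTensor, PiTensorProduct.lift.tprod,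
      PiTensorProduct.lift.tprod, MultilinearMap.mkPiAlgebraFin_apply,
      MultilinearMap.mkPiAlgebraFin_apply, List.ofFn_succ, List.prod_cons]
    simp
  | add x y hx hy =>
    rw [TensorProduct.tmul_add]
    simp only [map_add, hx, hy, mul_add]

end FQSym

theorem mainTheorem3 (K : Type*) [Field K] [CharZero K] (r : ℕ) (F : Fin r → FQSym K)
    (H : FQSym K) (hH : H ∈ FQSym.patrasReutenauer K) :
    FQSym.internal K (List.ofFn F).prod H =
      FQSym.mulTensor K r
        (FQSym.internalTensor K r (PiTensorProduct.tprod K F) (FQSym.iterComul K r H)) := by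
  open FQSym in
  induction r generalizing H with
  | zero =>
    clear hH
    -- For r = 0 the left factor is `G_∅`, whose internal product retains only the degree-zero part.
    have h : internal K (1 : FQSym K) = (counit K).smulRight (1 : FQSym K) := by
      refine linearMap_ext_G K fun n σ => ?_
      rw [one_def, internal, bilin_G, LinearMap.smulRight_apply, counit, G, Module.Basis.coord_apply,
        Module.Basis.repr_self, Finsupp.single_apply]
      rcases n with - | n
      · obtain rfl : σ = 1 := Subsingleton.elim _ _
        simp [G]
      · simp
    simp [h, iterComul, mulTensor, internalTensor, PiTensorProduct.map₂_tprod_tprod]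
  | succ r ih =>
    rcases r with - | r
    · simp [iterComul, mulTensor, internalTensor, PiTensorProduct.map₂_tprod_tprod,
        PiTensorProduct.subsingletonEquiv_symm_apply]
    · rw [List.ofFn_succ, List.prod_cons, internal_mul_left K _ _ hH]
      -- Writing ΔH with factors in 𝒜 makes the induction hypothesis applicable to the second
      -- factor.
      obtain ⟨t, ht⟩ := comul_mem K hH
      rw [iterComul, LinearMap.comp_apply, LinearMap.comp_apply, ← ht]
      clear ht
      induction t using TensorProduct.induction_on with
      | zero => simp
      | add x y hx hy => simp only [map_add, hx, hy]
      | tmul a b =>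
        change internal K (F 0) a * internal K _ (b : FQSym K) = mulTensor K _ (internalTensor K _ _
          (consTensor K _ ((a : FQSym K) ⊗ₜ iterComul K (r + 1) b)))
        rw [mulTensor_internalTensor_consTensor, ih _ _ b.2]
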